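/- There are constants $C$ and $c>0$ and a family $(\mathcal L_n)_{n\ge 1}$ of linear programs of the form $\max\{c_n^{\top}x : A_nx=b_n,\ x\ge 0\}$ with real data and linearly ordered variables, each given with an initial feasible basis $\beta_n$, such that for every $n\ge 1$ the following holds. (i) The size of $\mathcal L_n$, i.e. the number of constraints plus the number of variables plus the number of nonzero entries of $A_n$, is at most $C\cdot n$. (ii) The simplex algorithm started at $\beta_n$ performs at least $c\cdot 2^n$ pivot operations for every (deterministic or randomized) combination of Dantzig's, Bland's and the Largest Increase pivot rule (for a randomized combination: with probability one). Here the entering variable of each pivot is an improving one (with positive reduced cost): Dantzig's rule takes one of maximum reduced cost, Bland's rule the one of smallest index, and the Largest Increase rule one for which the objective value after the pivot is as large as possible; the leaving variable is one attaining the minimum in the ratio test. The algorithm stops when no variable is improving, or when no variable can leave. In a combination, the rule that selects the entering variable is chosen anew in every iteration, possibly at random and depending on all bases visited so far, and all ties are broken in an arbitrary (possibly random and history-dependent) way. The program $\mathcal L_n$, the order of its variables, the basis $\beta_n$ and the constants $C,c$ do not depend on the combination. -/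

import Mathlib

/-- A linear program in standard equality form with real data, constraints indexed by `ι` and
variables indexed by `κ`:  maximize `∑ j, c j * x j`  subject to  `A *ᵥ x = b`  and  `0 ≤ x`. -/
structure LinearProgram (ι κ : Type) where
  /-- constraint matrix -/
  A : Matrix ι κ ℝ
  /-- right-hand side -/
  b : ι → ℝ
  /-- objective function, to be maximized -/
  c : κ → ℝ

/-- The three classical pivot rules. -/
inductive PivotRule where
  | dantzig
  | bland
  | largestIncrease

namespace LinearProgram

noncomputable section

variable {ι κ : Type} [Fintype ι] [DecidableEq ι] [Fintype κ] [LinearOrder κ]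

/-- The size of a linear program: number of constraints, plus number of variables, plus number of
nonzero entries of the constraint matrix. -/
def size (L : LinearProgram ι κ) : ℕ :=
  Fintype.card ι + Fintype.card κ + {p : ι × κ | L.A p.1 p.2 ≠ 0}.ncard

/-- The square matrix of the columns chosen by `β`; here `β i` is the variable that is basic in
row `i`. -/
def basisMatrix (L : LinearProgram ι κ) (β : ι → κ) : Matrix ι ι ℝ :=
  L.A.submatrix id β

/-- The values of the basic variables in the basic solution of `β` (the nonbasic ones are `0`). -/
def basicValue (L : LinearProgram ι κ) (β : ι → κ) : ι → ℝ :=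
  (L.basisMatrix β)⁻¹.mulVec L.b

/-- The simplex tableau of `β`: column `j` expresses the column of variable `j` in the basis. -/
def tableau (L : LinearProgram ι κ) (β : ι → κ) : Matrix ι κ ℝ :=
  (L.basisMatrix β)⁻¹ * L.A

/-- The reduced cost of variable `j`: the rate of change of the objective when `j` enters. -/
def reducedCost (L : LinearProgram ι κ) (β : ι → κ) (j : κ) : ℝ :=
  L.c j - ∑ i, L.c (β i) * L.tableau β i j

/-- `β` is a feasible basis: its columns form a basis of the column space and its basic solution
is nonnegative. -/
def IsFeasibleBasis (L : LinearProgram ι κ) (β : ι → κ) : Prop :=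
  IsUnit (L.basisMatrix β).det ∧ ∀ i, 0 ≤ L.basicValue β i

/-- Variable `j` may enter the basis: its reduced cost is positive. -/
def Improving (L : LinearProgram ι κ) (β : ι → κ) (j : κ) : Prop :=
  0 < L.reducedCost β j

/-- `θ` is a feasible step length for the entering variable `j`: raising `j` from `0` to `θ`
(keeping the other nonbasic variables at `0`) keeps all basic variables nonnegative. The objective
then grows by `reducedCost β j * θ`. -/
def FeasibleStep (L : LinearProgram ι κ) (β : ι → κ) (j : κ) (θ : ℝ) : Prop :=
  0 ≤ θ ∧ ∀ i, L.tableau β i j * θ ≤ L.basicValue β i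

/-- The basic variable of row `i` may leave when `j` enters: it passes the minimum ratio test. -/
def MayLeave (L : LinearProgram ι κ) (β : ι → κ) (j : κ) (i : ι) : Prop :=
  0 < L.tableau β i j ∧ ∀ k, 0 < L.tableau β k j →
    L.basicValue β i / L.tableau β i j ≤ L.basicValue β k / L.tableau β k j

/-- Variable `j` is a possible choice of the given pivot rule at the basis `β`.
* Dantzig: `j` has maximum reduced cost.
* Bland: `j` is the improving variable of smallest index.
* Largest Increase: `j` is an improving variable whose pivot maximizes the resulting objective
  value, i.e. whatever increase can be reached by letting an improving variable `k` enter can be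
  matched by letting `j` enter. -/
def Selects (L : LinearProgram ι κ) (β : ι → κ) (j : κ) : PivotRule → Prop
  | .dantzig => L.Improving β j ∧ ∀ k, L.reducedCost β k ≤ L.reducedCost β j
  | .bland => L.Improving β j ∧ ∀ k, L.Improving β k → j ≤ k
  | .largestIncrease => L.Improving β j ∧ ∀ k, L.Improving β k → ∀ θ, L.FeasibleStep β k θ →
      ∃ θ', L.FeasibleStep β j θ' ∧ L.reducedCost β k * θ ≤ L.reducedCost β j * θ'

/-- The possible outcomes of one iteration of the simplex algorithm at the basis `β` when the
entering variable is chosen by one of the three rules. Outcome `some β'` is a pivot operation with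
new basis `β'`; outcome `none` means that the algorithm stops, either because no variable is
improving (`β` is optimal) or because no variable can leave (the program is unbounded). -/
def IsOutcome (L : LinearProgram ι κ) (β : ι → κ) : Option (ι → κ) → Prop
  | none => (∀ j, ¬ L.Improving β j) ∨
      ∃ r j, L.Selects β j r ∧ ∀ i, ¬ L.MayLeave β j i
  | some β' => ∃ r j i, L.Selects β j r ∧ L.MayLeave β j i ∧ β' = Function.update β i j

/-- A (deterministic or randomized) combination of the three pivot rules. Given the list of the
bases visited so far, the current basis `β` first, `σ` is the distribution of the outcome of the
next iteration; it may depend on the whole history, choose the rule at random and break ties in any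
way, but every outcome of positive probability has to come from one of the three rules.
A deterministic combination is one with values of the form `PMF.pure o`. -/
def IsCombination (L : LinearProgram ι κ) (σ : List (ι → κ) → PMF (Option (ι → κ))) : Prop :=
  ∀ (β : ι → κ) (h : List (ι → κ)), ∀ o ∈ (σ (β :: h)).support, L.IsOutcome β o

/-- The distribution of the number of pivot operations that are performed in the next `T`
iterations by the simplex algorithm with `σ`, if the bases visited so far are `h` (the current one
first). -/
def pivotCount (σ : List (ι → κ) → PMF (Option (ι → κ))) : ℕ → List (ι → κ) → PMF ℕ
  | 0, _ => PMF.pure 0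
  | T + 1, h => (σ h).bind fun o =>
      match o with
      | none => PMF.pure 0
      | some β => (pivotCount σ T (β :: h)).map (fun k => k + 1)

end

end LinearProgram

/-!
Each linear program is an iterated deformed product of hexagons. Level `i` has a value `α` and a
horizontal coordinate `z`. If `φ` is the value of the level below, then `(z, α)` ranges over the
hexagon `|z| ≤ δ`, `|z| ≤ α - φ`, `|z| ≤ H - φ - α`, where `δ = width i` and `H = top i`. The value
of the last level is maximized. At a vertex of the lower half of the hexagon `α = φ + |z|`, so that
`α` grows if the levels below move up; at a vertex of the upper half `α = H - φ - |z|`, so that `α`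
grows if they move down. Each constraint involves one level and the value of the level below, so the
number of nonzero entries is linear in the number of levels.

A monotone path that always moves the lowest possible level is long: on the way up, a level waits at
the bottom of its hexagon while the lower levels move all the way up, makes two steps into the upper
half, waits while the lower levels move all the way down, and makes a third step to the top. The way
down has the same form, since the hexagon is symmetric. Hence the length of the path satisfies
`f (n + 1) = 2 * f n + 3` (`pathLength`), and `OnPath` describes the states on such paths.

All three rules select a variable of the lowest level with an improving variable
(`IsBasisOf.not_advances_of_selects`).
* For Bland's rule this is the order of the variables.
* For Dantzig's rule the columns of level `i` are scaled by `3⁻ⁱ`, while the rates of change of `α`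
  along the edges of the hexagons differ by a factor of at most `2` (`rate_bounds`).
* The gain of a step is the change of `α` in the level that moves. It is at least `δ` for every edge
  (`width_le_abs`), and exactly `δ` for the edges inside one half (`abs_eq_width`). A level makes
  the long step between the halves only when no lower level can improve (`OnPath.half_eq`). As `δ`
  decreases with the level, Largest Increase prefers the lowest level, too.

The program is nondegenerate, so that an edge of the polytope determines the reduced cost, the
ratio test and the largest step of its entering variable from the coordinates of its two ends
(`LinearProgram.IsEdge`). No basis matrix is ever inverted.
-/

/-! ### Edges of a nondegenerate linear program and the pivot operation -/

namespace LinearProgram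

section Edges

variable {ι κ : Type} [Fintype ι]

/-- Basic variables are never improving. -/
theorem reducedCost_basic [DecidableEq ι] (L : LinearProgram ι κ) {β : ι → κ}
    (hdet : IsUnit (L.basisMatrix β).det) (i : ι) : L.reducedCost β (β i) = 0 := by
  have h : ∀ k, L.tableau β k (β i) = (1 : Matrix ι ι ℝ) k i := fun k => by
    rw [← Matrix.nonsing_inv_mul _ hdet]
    rfl
  simp [reducedCost, h, Matrix.one_apply]

variable [Fintype κ]

theorem mulVec_eq_basisMatrix_mulVec (L : LinearProgram ι κ) {β : ι → κ}
    (hβ : Function.Injective β) {x : κ → ℝ} (hx : ∀ k, k ∉ Set.range β → x k = 0) :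
    L.A.mulVec x = (L.basisMatrix β).mulVec (x ∘ β) := by
  ext r
  simp only [Matrix.mulVec, dotProduct, basisMatrix, Matrix.submatrix_apply, id, Function.comp]
  exact (Fintype.sum_of_injective β hβ _ _ (fun k hk => by simp [hx k hk]) (fun i => rfl)).symm

variable [DecidableEq ι]

/-- A selection of columns is a basis if every solution of the homogeneous equations that is
supported on it vanishes. -/
theorem isUnit_basisMatrix (L : LinearProgram ι κ) {β : ι → κ} (hβ : Function.Injective β)
    (h : ∀ d : κ → ℝ, L.A.mulVec d = 0 → (∀ k, k ∉ Set.range β → d k = 0) → d = 0) :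
    IsUnit (L.basisMatrix β).det := by
  rw [← Matrix.isUnit_iff_isUnit_det, ← Matrix.mulVec_injective_iff_isUnit,
    ← Matrix.coe_mulVecLin, injective_iff_map_eq_zero]
  intro v hv
  have hcomp : Function.extend β v 0 ∘ β = v := by
    ext i
    simp [hβ.extend_apply]
  have hoff : ∀ k, k ∉ Set.range β → Function.extend β v 0 k = 0 := fun k hk => by
    rw [Function.extend_apply' _ _ _ (by simpa using hk)]
    rfl
  have h0 := h (Function.extend β v 0) (by
    rw [mulVec_eq_basisMatrix_mulVec L hβ hoff, hcomp]
    exact hv) hoff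
  rw [← hcomp, h0]
  rfl

theorem basicValue_eq (L : LinearProgram ι κ) {β : ι → κ} (hβ : Function.Injective β)
    (hdet : IsUnit (L.basisMatrix β).det) {x : κ → ℝ} (hA : L.A.mulVec x = L.b)
    (hx : ∀ k, k ∉ Set.range β → x k = 0) (i : ι) : L.basicValue β i = x (β i) := by
  rw [basicValue, ← hA, mulVec_eq_basisMatrix_mulVec L hβ hx, Matrix.mulVec_mulVec,
    Matrix.nonsing_inv_mul _ hdet, Matrix.one_mulVec]
  rfl

/-- Let `x` be the basic solution of `β` and let `y` be another solution of the equations at which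
`j` is the only nonbasic variable that may be nonzero. Then `y - x` is a multiple of the
`j`-th edge direction, so that it determines the `j`-th column of the tableau. -/
theorem tableau_mul_eq (L : LinearProgram ι κ) {β : ι → κ} (hβ : Function.Injective β)
    (hdet : IsUnit (L.basisMatrix β).det) {x y : κ → ℝ} (hxA : L.A.mulVec x = L.b)
    (hyA : L.A.mulVec y = L.b) (hx : ∀ k, k ∉ Set.range β → x k = 0) {j : κ}
    (hj : j ∉ Set.range β) (hy : ∀ k, k ∉ Set.range β → k ≠ j → y k = 0) (i : ι) :
    L.tableau β i j * y j = x (β i) - y (β i) := by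
  classical
  have hsplit : y = Function.update y j 0 + Pi.single j (y j) := by
    ext k
    rcases eq_or_ne k j with rfl | hk <;> simp [*]
  have hcomp : Function.update y j 0 ∘ β = y ∘ β := by
    ext k
    have : β k ≠ j := fun h => hj ⟨k, h⟩
    simp [this]
  have h1 : L.A.mulVec (Function.update y j 0) = (L.basisMatrix β).mulVec (y ∘ β) := by
    rw [mulVec_eq_basisMatrix_mulVec L hβ, hcomp]
    intro k hk
    rcases eq_or_ne k j with rfl | hkj
    · simp
    · simp [hkj, hy k hk hkj]
  have h2 : (L.basisMatrix β).mulVec (x ∘ β)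
      = (L.basisMatrix β).mulVec (y ∘ β) + y j • L.A.col j := by
    rw [← mulVec_eq_basisMatrix_mulVec L hβ hx, hxA, ← hyA, ← h1]
    conv_lhs => rw [hsplit]
    rw [Matrix.mulVec_add]
    congr 1
    ext r
    simp [mul_comm]
  have h3 := congrArg ((L.basisMatrix β)⁻¹.mulVec) h2
  rw [Matrix.mulVec_add, Matrix.mulVec_mulVec, Matrix.mulVec_mulVec,
    Matrix.nonsing_inv_mul _ hdet, Matrix.one_mulVec, Matrix.one_mulVec, Matrix.mulVec_smul] at h3
  have h4 := congrFun h3 i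
  have h5 : ((L.basisMatrix β)⁻¹.mulVec (L.A.col j)) i = L.tableau β i j := rfl
  simp only [Pi.add_apply, Pi.smul_apply, smul_eq_mul, Function.comp, h5] at h4
  linarith

theorem reducedCost_mul_eq (L : LinearProgram ι κ) {β : ι → κ} (hβ : Function.Injective β)
    (hdet : IsUnit (L.basisMatrix β).det) {x y : κ → ℝ} (hxA : L.A.mulVec x = L.b)
    (hyA : L.A.mulVec y = L.b) (hx : ∀ k, k ∉ Set.range β → x k = 0) {j : κ}
    (hj : j ∉ Set.range β) (hy : ∀ k, k ∉ Set.range β → k ≠ j → y k = 0) :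
    L.reducedCost β j * y j = L.c ⬝ᵥ y - L.c ⬝ᵥ x := by
  classical
  have hcx : L.c ⬝ᵥ x = ∑ i, L.c (β i) * x (β i) :=
    (Fintype.sum_of_injective β hβ _ _ (fun k hk => by simp [hx k hk]) (fun i => rfl)).symm
  have hcy : L.c ⬝ᵥ y = L.c j * y j + ∑ i, L.c (β i) * y (β i) := by
    have h1 : ∑ i, L.c (β i) * y (β i) = ∑ k, L.c k * Function.update y j 0 k := by
      refine Fintype.sum_of_injective β hβ _ _ (fun k hk => ?_) (fun i => ?_)
      · rcases eq_or_ne k j with rfl | hkj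
        · simp
        · simp [hkj, hy k hk hkj]
      · have : β i ≠ j := fun h => hj ⟨i, h⟩
        simp [this]
    rw [h1, dotProduct, ← Finset.add_sum_erase _ _ (Finset.mem_univ j),
      ← Finset.add_sum_erase Finset.univ (fun k => L.c k * Function.update y j 0 k)
        (Finset.mem_univ j)]
    simp only [Function.update_self, mul_zero, zero_add]
    congr 1
    refine Finset.sum_congr rfl fun k hk => ?_
    rw [Function.update_of_ne (Finset.ne_of_mem_erase hk)]
  rw [reducedCost, sub_mul, Finset.sum_mul, hcx, hcy]
  simp only [mul_assoc, tableau_mul_eq L hβ hdet hxA hyA hx hj hy, mul_sub, Finset.sum_sub_distrib]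
  ring

/-- The two ends of an edge: `x` is the basic solution of `β`, and `y` is the vertex that is
reached when `j` enters; `l` is the variable that becomes `0` there. All variables which are not
forced to be `0` are positive, i.e. both vertices are nondegenerate. -/
structure IsEdge (L : LinearProgram ι κ) (β : ι → κ) (x y : κ → ℝ) (j l : κ) : Prop where
  injective : Function.Injective β
  isUnit_det : IsUnit (L.basisMatrix β).det
  mulVec_left : L.A.mulVec x = L.b
  mulVec_right : L.A.mulVec y = L.b
  left_eq_zero : ∀ k, k ∉ Set.range β → x k = 0
  left_pos : ∀ k, k ∈ Set.range β → 0 < x k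
  entering : j ∉ Set.range β
  leaving : l ∈ Set.range β
  right_eq_zero : ∀ k, k ∉ Set.range β → k ≠ j → y k = 0
  right_leaving : y l = 0
  right_entering : 0 < y j
  right_pos : ∀ k, k ∈ Set.range β → k ≠ l → 0 < y k

namespace IsEdge

variable {L : LinearProgram ι κ} {β : ι → κ} {x y : κ → ℝ} {j l : κ}

theorem basicValue_eq (h : L.IsEdge β x y j l) (i : ι) : L.basicValue β i = x (β i) :=
  LinearProgram.basicValue_eq L h.injective h.isUnit_det h.mulVec_left h.left_eq_zero i

theorem tableau_eq (h : L.IsEdge β x y j l) (i : ι) :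
    L.tableau β i j = (x (β i) - y (β i)) / y j := by
  rw [eq_div_iff h.right_entering.ne']
  exact tableau_mul_eq L h.injective h.isUnit_det h.mulVec_left h.mulVec_right h.left_eq_zero
    h.entering h.right_eq_zero i

theorem reducedCost_mul (h : L.IsEdge β x y j l) :
    L.reducedCost β j * y j = L.c ⬝ᵥ y - L.c ⬝ᵥ x :=
  reducedCost_mul_eq L h.injective h.isUnit_det h.mulVec_left h.mulVec_right h.left_eq_zero
    h.entering h.right_eq_zero

theorem improving_iff (h : L.IsEdge β x y j l) : L.Improving β j ↔ L.c ⬝ᵥ x < L.c ⬝ᵥ y := by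
  rw [Improving, ← sub_pos (a := L.c ⬝ᵥ y), ← h.reducedCost_mul,
    mul_pos_iff_of_pos_right h.right_entering]

theorem mayLeave_iff (h : L.IsEdge β x y j l) (i : ι) : L.MayLeave β j i ↔ β i = l := by
  have hj := h.right_entering
  -- the ratio of a variable is the step length at which it would become `0`
  have key : ∀ k, 0 < L.tableau β k j →
      y j ≤ L.basicValue β k / L.tableau β k j ∧
      (β k ≠ l → y j < L.basicValue β k / L.tableau β k j) := by
    intro k hk
    have hT := h.tableau_eq k
    rw [le_div_iff₀ hk, lt_div_iff₀ hk, h.basicValue_eq, hT, mul_div_cancel₀ _ hj.ne']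
    constructor
    · rcases eq_or_ne (β k) l with hl | hl
      · simp [hl, h.right_leaving]
      · linarith [h.right_pos _ ⟨k, rfl⟩ hl]
    · intro hl
      linarith [h.right_pos _ ⟨k, rfl⟩ hl]
  have hl : ∀ k, β k = l → 0 < L.tableau β k j ∧
      L.basicValue β k / L.tableau β k j = y j := by
    intro k hk
    have hx := h.left_pos _ ⟨k, rfl⟩
    rw [hk] at hx
    rw [h.tableau_eq, h.basicValue_eq, hk, h.right_leaving, sub_zero]
    refine ⟨by positivity, ?_⟩
    field_simp
  constructor
  · rintro ⟨h1, h2⟩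
    by_contra hne
    obtain ⟨k, hk⟩ := h.leaving
    have := h2 k (hl k hk).1
    rw [(hl k hk).2] at this
    exact absurd ((key i h1).2 hne) (not_lt.mpr this)
  · intro hi
    refine ⟨(hl i hi).1, fun k hk => ?_⟩
    rw [(hl i hi).2]
    exact (key k hk).1

theorem feasibleStep_right (h : L.IsEdge β x y j l) : L.FeasibleStep β j (y j) := by
  refine ⟨h.right_entering.le, fun i => ?_⟩
  rw [h.tableau_eq, h.basicValue_eq, div_mul_cancel₀ _ h.right_entering.ne']
  rcases eq_or_ne (β i) l with hl | hl
  · simp [hl, h.right_leaving]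
  · linarith [h.right_pos _ ⟨i, rfl⟩ hl]

theorem le_of_feasibleStep (h : L.IsEdge β x y j l) {θ : ℝ} (hθ : L.FeasibleStep β j θ) :
    θ ≤ y j := by
  obtain ⟨k, hk⟩ := h.leaving
  have h1 := hθ.2 k
  have hx := h.left_pos _ ⟨k, rfl⟩
  have hj := h.right_entering
  rw [h.tableau_eq, h.basicValue_eq, hk, h.right_leaving, sub_zero, div_mul_eq_mul_div,
    div_le_iff₀ hj] at h1
  rw [hk] at hx
  exact le_of_mul_le_mul_left h1 hx

end IsEdge

end Edges

section Counting

variable {ι κ : Type} [Fintype ι] [DecidableEq ι] [LinearOrder κ]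

/-- If `Good (r + 1)` guarantees a pivot to a basis with `Good r`, whatever the outcome of the
iteration, then at least `r` pivots are performed from a basis with `Good r`. -/
theorem min_le_of_mem_support_pivotCount {L : LinearProgram ι κ} {Good : ℕ → (ι → κ) → Prop}
    (hGood : ∀ r β, Good (r + 1) β → ∀ o, L.IsOutcome β o → ∃ β', o = some β' ∧ Good r β')
    {σ : List (ι → κ) → PMF (Option (ι → κ))} (hσ : L.IsCombination σ) (T : ℕ) :
    ∀ (r : ℕ) (β : ι → κ) (h : List (ι → κ)), Good r β →
      ∀ k ∈ (pivotCount σ T (β :: h)).support, min T r ≤ k := by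
  induction T with
  | zero => intros; simp
  | succ T ih =>
    intro r β h hβ k hk
    rcases r with _ | r
    · simp
    rw [pivotCount, PMF.mem_support_bind_iff] at hk
    obtain ⟨o, ho, hk⟩ := hk
    obtain ⟨β', rfl, hβ'⟩ := hGood r β hβ o (hσ β h o ho)
    simp only [PMF.mem_support_map_iff] at hk
    obtain ⟨k', hk', rfl⟩ := hk
    have := ih r β' (β :: h) hβ' k' hk'
    omega

end Counting

end LinearProgram

/-! ### The hexagon as a graph -/

/-- A vertex of the hexagon of a level: the Boolean tells whether it lies in the upper half, and
the sign is that of the horizontal coordinate. The lowest vertex is `(false, 0)`, the highest one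
`(true, 0)`. -/
abbrev HexVertex : Type := Bool × SignType

namespace HexVertex

/-- Two vertices of the hexagon that are joined by an edge. -/
def Adj (v w : HexVertex) : Prop :=
  (v.1 = w.1 ∧ (v.2 = 0 ↔ w.2 ≠ 0)) ∨ (v.1 = !w.1 ∧ v.2 = w.2 ∧ v.2 ≠ 0)

instance : DecidableRel Adj := fun _ _ => by unfold Adj; infer_instance

/-- The distance of a vertex from the starting point of a monotone path through the hexagon:
from the lowest vertex if `d = false`, from the highest vertex if `d = true`. -/
def height (d : Bool) (v : HexVertex) : ℕ :=
  match xor v.1 d, decide (v.2 = 0) with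
  | false, true => 0
  | false, false => 1
  | true, false => 2
  | true, true => 3

theorem height_lt_of_adj_zero : ∀ {d : Bool} {v w : HexVertex}, Adj v w →
    height d v < height d w → xor v.1 d = false → v.2 = 0 → w.1 = v.1 ∧ w.2 ≠ 0 := by
  decide

set_option synthInstance.maxSize 400 in
theorem height_lt_of_adj_one : ∀ {d : Bool} {v w : HexVertex}, Adj v w →
    height d v < height d w → xor v.1 d = false → v.2 ≠ 0 → w.1 = !v.1 ∧ w.2 ≠ 0 := by
  decide

theorem height_lt_of_adj_two : ∀ {d : Bool} {v w : HexVertex}, Adj v w →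
    height d v < height d w → xor v.1 d = true → v.2 ≠ 0 ∧ w.1 = v.1 ∧ w.2 = 0 := by
  decide

theorem exists_height_lt : ∀ {d : Bool} {v : HexVertex}, (xor v.1 d = false ∨ v.2 ≠ 0) →
    ∃ w, Adj v w ∧ height d v < height d w := by
  decide

end HexVertex

/-! ### The long path -/

namespace HexLP

open HexVertex

/-- The direction in which level `i` has to move in order to move level `n - 1` in direction `d`
(`false` for up, `true` for down): every level between them whose hexagon is at a vertex of its
upper half reverses the direction. -/
def levelDir (s : ℕ → HexVertex) : ℕ → Bool → ℕ → Bool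
  | 0, d, _ => d
  | n + 1, d, i => if i = n then d else levelDir s n (xor (s n).1 d) i

/-- Replacing the vertex of level `i < n` by `w` is a step along an edge of the hexagon which moves
level `n - 1` in direction `d`. -/
def Advances (s : ℕ → HexVertex) (n : ℕ) (d : Bool) (i : ℕ) (w : HexVertex) : Prop :=
  i < n ∧ Adj (s i) w ∧ height (levelDir s n d i) (s i) < height (levelDir s n d i) w

/-- The number of steps of the long monotone path through `n` levels. -/
def pathLength : ℕ → ℕ
  | 0 => 0
  | n + 1 => 2 * pathLength n + 3

/-- The state `s` of the first `n` levels lies on a long path in direction `d`, at `r` steps from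
its end. Level `n` takes part in this path as follows: it waits at its starting vertex until the
lower levels have moved all the way up, makes two steps, waits until the lower levels have moved
all the way down, and makes a third step. -/
def OnPath (s : ℕ → HexVertex) : ℕ → Bool → ℕ → Prop
  | 0, _, r => r = 0
  | n + 1, d, r =>
      (xor (s n).1 d = false ∧ (s n).2 = 0 ∧ ∃ q, OnPath s n false q ∧ r = q + pathLength n + 3) ∨
      (xor (s n).1 d = false ∧ (s n).2 ≠ 0 ∧ OnPath s n false 0 ∧ r = pathLength n + 2) ∨
      (xor (s n).1 d = true ∧ (s n).2 ≠ 0 ∧ ∃ q, OnPath s n true q ∧ r = q + 1) ∨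
      (xor (s n).1 d = true ∧ (s n).2 = 0 ∧ OnPath s n true 0 ∧ r = 0)

theorem two_pow_le_pathLength {n : ℕ} (hn : 1 ≤ n) : 2 ^ n ≤ pathLength n := by
  induction n, hn using Nat.le_induction with
  | base => simp [pathLength]
  | succ n _ ih => rw [pow_succ, pathLength]; omega

theorem onPath_congr {s s' : ℕ → HexVertex} {n : ℕ} (h : ∀ k < n, s k = s' k) (d : Bool) (r : ℕ) :
    OnPath s n d r ↔ OnPath s' n d r := by
  induction n generalizing d r with
  | zero => rfl
  | succ n ih =>
    have ih' := fun d r => ih (fun k hk => h k (by omega)) d r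
    simp only [OnPath, h n (by omega), ih']

/-- The end of a path is the starting point of a path in the opposite direction. -/
theorem OnPath.reverse {s : ℕ → HexVertex} {n : ℕ} {d : Bool} (h : OnPath s n d 0) :
    OnPath s n (!d) (pathLength n) := by
  induction n generalizing d with
  | zero => rfl
  | succ n ih =>
    simp only [OnPath] at h ⊢
    rcases h with ⟨_, _, q, _, h⟩ | ⟨_, _, _, h⟩ | ⟨_, _, q, _, h⟩ | ⟨h1, h2, h3, -⟩
    · omega
    · omega
    · omega
    · exact Or.inl ⟨by simpa using h1, h2, _, ih h3, by rw [pathLength]; ring⟩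

theorem onPath_start {s : ℕ → HexVertex} (hs : ∀ i, s i = (false, 0)) (n : ℕ) :
    OnPath s n false (pathLength n) := by
  induction n with
  | zero => rfl
  | succ n ih => exact Or.inl ⟨by simp [hs], by simp [hs], _, ih, by rw [pathLength]; ring⟩

theorem advances_succ {s : ℕ → HexVertex} {n : ℕ} {d : Bool} {i : ℕ} {w : HexVertex} :
    Advances s (n + 1) d i w ↔ (i = n ∧ Adj (s n) w ∧ height d (s n) < height d w) ∨
      Advances s n (xor (s n).1 d) i w := by
  unfold Advances
  rcases eq_or_ne i n with rfl | hi
  · simp [levelDir]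
  · simp only [levelDir, hi, if_false, false_and, false_or]
    constructor
    · rintro ⟨h, h'⟩; exact ⟨by omega, h'⟩
    · rintro ⟨h, h'⟩; exact ⟨by omega, h'⟩

theorem OnPath.not_advances {s : ℕ → HexVertex} {n : ℕ} {d : Bool} (h : OnPath s n d 0) (i : ℕ)
    (w : HexVertex) : ¬ Advances s n d i w := by
  induction n generalizing d with
  | zero => rintro ⟨hi, -⟩; omega
  | succ n ih =>
    rcases h with ⟨_, _, q, _, h⟩ | ⟨_, _, _, h⟩ | ⟨_, _, q, _, h⟩ | ⟨h1, h2, h3, -⟩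
    · omega
    · omega
    · omega
    · rw [advances_succ, h1]
      rintro (⟨rfl, ha, hh⟩ | ha)
      · exact (height_lt_of_adj_two ha hh h1).1 h2
      · exact ih h3 ha

theorem OnPath.exists_advances {s : ℕ → HexVertex} {n : ℕ} {d : Bool} {r : ℕ}
    (h : OnPath s n d r) (hr : r ≠ 0) : ∃ i w, Advances s n d i w := by
  cases n with
  | zero => exact absurd h hr
  | succ n =>
    have h' : xor (s n).1 d = false ∨ (s n).2 ≠ 0 := by
      rcases h with ⟨h, _⟩ | ⟨h, _⟩ | ⟨_, h, _⟩ | ⟨_, _, _, h⟩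
      · exact Or.inl h
      · exact Or.inl h
      · exact Or.inr h
      · exact absurd h hr
    obtain ⟨w, hw⟩ := exists_height_lt h'
    exact ⟨n, w, advances_succ.mpr (Or.inl ⟨rfl, hw⟩)⟩

/-- An advancing step at the lowest possible level leads to the next state of the path. -/
theorem OnPath.step {s : ℕ → HexVertex} {n : ℕ} {d : Bool} {r : ℕ} (h : OnPath s n d (r + 1))
    {i : ℕ} {w : HexVertex} (hw : Advances s n d i w)
    (hmin : ∀ k < i, ∀ v, ¬ Advances s n d k v) : OnPath (Function.update s i w) n d r := by
  induction n generalizing d r with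
  | zero => exact absurd h (by simp [OnPath])
  | succ n ih =>
    rcases advances_succ.mp hw with ⟨rfl, ha, hh⟩ | hw'
    · have hlow : ∀ e q, OnPath (Function.update s i w) i e q ↔ OnPath s i e q := fun e q =>
        onPath_congr (fun k hk => Function.update_of_ne hk.ne _ _) e q
      have hdone : ∀ q, OnPath s i (xor (s i).1 d) q → q = 0 := by
        intro q hq
        by_contra hq0
        obtain ⟨k, v, hv⟩ := hq.exists_advances hq0
        exact hmin k hv.1 v (advances_succ.mpr (Or.inr hv))
      simp only [OnPath, Function.update_self, hlow]
      rcases h with ⟨h1, h2, q, h3, h4⟩ | ⟨h1, h2, h3, h4⟩ | ⟨h1, h2, q, h3, h4⟩ | ⟨_, _, _, h⟩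
      · obtain rfl := hdone q (h1 ▸ h3)
        obtain ⟨hw1, hw2⟩ := height_lt_of_adj_zero ha hh h1 h2
        exact Or.inr (Or.inl ⟨by rw [hw1, h1], hw2, h3, by omega⟩)
      · obtain ⟨hw1, hw2⟩ := height_lt_of_adj_one ha hh h1 h2
        exact Or.inr (Or.inr (Or.inl ⟨by rw [hw1, Bool.not_xor, h1, Bool.not_false], hw2, _,
          h3.reverse, by omega⟩))
      · obtain rfl := hdone q (h1 ▸ h3)
        obtain ⟨-, hw1, hw2⟩ := height_lt_of_adj_two ha hh h1
        exact Or.inr (Or.inr (Or.inr ⟨by rw [hw1, h1], hw2, h3, by omega⟩))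
      · omega
    · have hn : Function.update s i w n = s n :=
        Function.update_of_ne (by have := hw'.1; omega) _ _
      have hmin' : ∀ k < i, ∀ v, ¬ Advances s n (xor (s n).1 d) k v := fun k hk v hv =>
        hmin k hk v (advances_succ.mpr (Or.inr hv))
      simp only [OnPath, hn]
      rcases h with ⟨h1, h2, q, h3, h4⟩ | ⟨h1, h2, h3, h4⟩ | ⟨h1, h2, q, h3, h4⟩ | ⟨_, _, _, h⟩
      · rw [h1] at hw' hmin'
        rcases q with _ | q
        · exact absurd hw' (h3.not_advances i w)
        · exact Or.inl ⟨h1, h2, q, ih h3 hw' hmin', by omega⟩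
      · rw [h1] at hw'
        exact absurd hw' (h3.not_advances i w)
      · rw [h1] at hw' hmin'
        rcases q with _ | q
        · exact absurd hw' (h3.not_advances i w)
        · exact Or.inr (Or.inr (Or.inl ⟨h1, h2, q, ih h3 hw' hmin', by omega⟩))
      · omega

/-- A level changes between the halves of its hexagon only after all lower levels are done. -/
theorem OnPath.half_eq {s : ℕ → HexVertex} {n : ℕ} {d : Bool} {r : ℕ} (h : OnPath s n d r)
    {i : ℕ} {w : HexVertex} (hw : Advances s n d i w) {k : ℕ} {v : HexVertex}
    (hv : Advances s n d k v) (hki : k < i) : (s i).1 = w.1 := by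
  induction n generalizing d r with
  | zero => exact absurd hw.1 (by omega)
  | succ n ih =>
    rcases advances_succ.mp hv with ⟨rfl, -⟩ | hv'
    · exact absurd hw.1 (by omega)
    rcases advances_succ.mp hw with ⟨rfl, ha, hh⟩ | hw'
    · rcases h with ⟨h1, h2, -⟩ | ⟨h1, h2, h3, h4⟩ | ⟨h1, h2, -⟩ | ⟨h1, h2, -⟩
      · exact (height_lt_of_adj_zero ha hh h1 h2).1.symm
      · exact absurd (h1 ▸ hv') (h3.not_advances k v)
      · exact (height_lt_of_adj_two ha hh h1).2.1.symm
      · exact absurd h2 (height_lt_of_adj_two ha hh h1).1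
    · obtain ⟨e, q, h'⟩ : ∃ e q, xor (s n).1 d = e ∧ OnPath s n e q := by
        rcases h with ⟨h1, -, q, h3, -⟩ | ⟨h1, -, h3, -⟩ | ⟨h1, -, q, h3, -⟩ | ⟨h1, -, h3, -⟩
        · exact ⟨_, _, h1, h3⟩
        · exact ⟨_, _, h1, h3⟩
        · exact ⟨_, _, h1, h3⟩
        · exact ⟨_, _, h1, h3⟩
      rw [h'.1] at hv' hw'
      exact ih h'.2 hw' hv'

/-! ### The hexagon of a level in coordinates -/

noncomputable section

/-- Half of the width of the hexagon of level `i`; also the gain of a step inside one half of the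
hexagon. It has to decrease with the level, for the Largest Increase rule. -/
def width (i : ℕ) : ℝ := 1 / (i + 2)

/-- The height of the hexagon of level `i` over the value `0` of the level below. It is at least four
times the largest value of the level below (`value_bounds`), which makes the step between the halves
of the hexagon longer than `width i`. -/
def top (i : ℕ) : ℝ := 4 ^ (i + 2)

/-- The scaling of the columns of level `i`. It decreases by more than the factor `2` by which the
rates of change along the edges of a hexagon differ, for Dantzig's rule. -/
def scale (i : ℕ) : ℝ := (1 / 3) ^ i

theorem width_pos (i : ℕ) : 0 < width i := by unfold width; positivity

theorem width_le_half (i : ℕ) : width i ≤ 1 / 2 := by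
  unfold width
  exact one_div_le_one_div_of_le (by norm_num) (by linarith [(Nat.cast_nonneg i : (0 : ℝ) ≤ i)])

theorem width_lt {i k : ℕ} (h : k < i) : width i < width k := by
  unfold width
  have : (k : ℝ) < i := by exact_mod_cast h
  exact one_div_lt_one_div_of_lt (by positivity) (by linarith)

theorem scale_pos (i : ℕ) : 0 < scale i := by unfold scale; positivity

theorem scale_lt {i k : ℕ} (h : k < i) : scale i < scale k / 2 := by
  have h1 : scale i ≤ scale (k + 1) := by
    unfold scale
    exact pow_le_pow_of_le_one (by norm_num) (by norm_num) h
  have h2 : scale (k + 1) = scale k / 3 := by unfold scale; rw [pow_succ]; ring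
  linarith [scale_pos k]

/-- The coordinates of level `i` if the level below has the value `φ` and the level itself the
value `α` and the horizontal coordinate `z`. Column `0` is the value; columns `1` to `6` are the
scaled slacks of the hexagon `|z| ≤ α - φ`, `|z| ≤ top i - φ - α`, `|z| ≤ width i`. -/
def coord (i : ℕ) (φ α z : ℝ) : Fin 7 → ℝ :=
  ![α, (α - φ - z) / scale i, (α - φ + z) / scale i, (top i - φ - α - z) / scale i,
    (top i - φ - α + z) / scale i, (width i + z) / scale i, (width i - z) / scale i]

/-- The coefficients of the variables of level `i` in the five equations of that level. -/
def block (i : ℕ) : Fin 5 → Fin 7 → ℝ :=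
  ![![0, 0, 0, 0, 0, 1, 1],
    ![1, -scale i, 0, 0, 0, -scale i, 0],
    ![1, 0, -scale i, 0, 0, scale i, 0],
    ![1, 0, 0, scale i, 0, scale i, 0],
    ![1, 0, 0, 0, scale i, -scale i, 0]]

/-- The coefficients of the value of the level below in the five equations of a level. -/
def link : Fin 5 → ℝ := ![0, -1, -1, 1, 1]

/-- The right-hand sides of the five equations of level `i`. -/
def rhs (i : ℕ) : Fin 5 → ℝ :=
  ![2 * width i / scale i, -width i, width i, top i + width i, top i - width i]

theorem sum_block_coord (i : ℕ) (φ α z : ℝ) (r : Fin 5) :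
    ∑ t, block i r t * coord i φ α z t + link r * φ = rhs i r := by
  have := (scale_pos i).ne'
  fin_cases r <;> simp [block, coord, link, rhs, Fin.sum_univ_succ] <;> field_simp <;> ring

/-- The variables of a level that vanish at a vertex of its hexagon. -/
def zeroSet (v : HexVertex) : Finset (Fin 7) :=
  match v with
  | (false, .zero) => {1, 2}
  | (false, .pos) => {1, 6}
  | (false, .neg) => {2, 5}
  | (true, .zero) => {3, 4}
  | (true, .pos) => {3, 6}
  | (true, .neg) => {4, 5}

/-- Going from `v` to `w`, variable `t` enters and variable `l` leaves. -/
def Pivot (v w : HexVertex) (t l : Fin 7) : Prop :=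
  t ∈ zeroSet v ∧ l ∉ zeroSet v ∧ zeroSet w = insert l ((zeroSet v).erase t)

instance (v w : HexVertex) (t l : Fin 7) : Decidable (Pivot v w t l) := by
  unfold Pivot; infer_instance

theorem exists_pivot_of_mem : ∀ {v : HexVertex} {t : Fin 7}, t ∈ zeroSet v →
    ∃ w l, Adj v w ∧ Pivot v w t l := by
  decide

theorem exists_pivot_of_adj : ∀ {v w : HexVertex}, Adj v w → ∃ t l, Pivot v w t l := by
  decide

/-- The horizontal coordinate `z` of a vertex of level `i`. -/
def horiz (i : ℕ) (v : HexVertex) : ℝ := width i * (v.2 : ℝ)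

/-- The value of a vertex of level `i` if the level below has the value `φ`. -/
def nextValue (i : ℕ) (φ : ℝ) (v : HexVertex) : ℝ :=
  if v.1 then top i - φ - |horiz i v| else φ + |horiz i v|

/-- The value of level `n - 1` in state `s`; a fictitious level below level `0` has the constant
value `1`. -/
def value (s : ℕ → HexVertex) : ℕ → ℝ
  | 0 => 1
  | n + 1 => nextValue n (value s n) (s n)

theorem abs_horiz (i : ℕ) (v : HexVertex) :
    |horiz i v| = if v.2 = 0 then 0 else width i := by
  have := width_pos i
  rcases v with ⟨b, σ⟩
  rcases σ <;> simp [horiz, abs_of_pos this]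

theorem value_bounds (s : ℕ → HexVertex) (n : ℕ) :
    1 ≤ value s n ∧ 4 * value s n ≤ top n := by
  have h4 : ∀ n, top (n + 1) = 4 * top n := fun n => by unfold top; ring
  induction n with
  | zero => constructor <;> norm_num [value, top]
  | succ n ih =>
    obtain ⟨ih1, ih2⟩ := ih
    have h1 := width_pos n
    have h2 := width_le_half n
    have h3 : (0 : ℝ) ≤ |horiz n (s n)| := abs_nonneg _
    have h5 : |horiz n (s n)| ≤ 1 := by rw [abs_horiz]; split <;> linarith
    rw [h4, value, nextValue]
    split <;> constructor <;> linarith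

/-- The vertices of the hexagon are nondegenerate. -/
theorem coord_zero_or_pos (i : ℕ) {φ : ℝ} (hφ : 1 ≤ φ) (hφ' : 4 * φ ≤ top i) (v : HexVertex)
    (t : Fin 7) : (t ∈ zeroSet v → coord i φ (nextValue i φ v) (horiz i v) t = 0) ∧
      (t ∉ zeroSet v → 0 < coord i φ (nextValue i φ v) (horiz i v) t) := by
  have h1 := width_pos i
  have h2 := width_le_half i
  have h3 := scale_pos i
  rcases v with ⟨_ | _, _ | _ | _⟩ <;> fin_cases t <;>
    simp [zeroSet, coord, nextValue, horiz, abs_of_pos h1] <;>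
    first
    | linarith
    | exact Or.inl (by linarith)
    | exact div_pos (by linarith) h3

/-- For a fixed level below, the value is monotone along both sides of the hexagon. -/
theorem nextValue_lt_iff (i : ℕ) {φ : ℝ} (hφ : 1 ≤ φ) (hφ' : 4 * φ ≤ top i) {v w : HexVertex}
    (h : Adj v w) (d : Bool) :
    height d v < height d w ↔
      (if d then nextValue i φ w < nextValue i φ v else nextValue i φ v < nextValue i φ w) := by
  have h1 := width_pos i
  have h2 := width_le_half i
  simp only [nextValue, abs_horiz]
  revert h
  rcases v with ⟨_ | _, _ | _ | _⟩ <;> rcases w with ⟨_ | _, _ | _ | _⟩ <;> cases d <;>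
    simp [Adj, height] <;> linarith

/-- Every edge of the hexagon changes the value by at least `width i`. -/
theorem width_le_abs (i : ℕ) {φ : ℝ} (hφ : 1 ≤ φ) (hφ' : 4 * φ ≤ top i) {v w : HexVertex}
    (h : Adj v w) : width i ≤ |nextValue i φ w - nextValue i φ v| := by
  have h1 := width_pos i
  have h2 := width_le_half i
  simp only [nextValue, abs_horiz]
  revert h
  rcases v with ⟨_ | _, _ | _ | _⟩ <;> rcases w with ⟨_ | _, _ | _ | _⟩ <;>
    simp [Adj, le_abs] <;> first | (left; linarith) | (right; linarith)

/-- An edge inside one half of the hexagon changes the value by exactly `width i`. -/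
theorem abs_eq_width (i : ℕ) (φ : ℝ) {v w : HexVertex} (h : Adj v w) (hvw : v.1 = w.1) :
    |nextValue i φ w - nextValue i φ v| = width i := by
  have h1 := width_pos i
  simp only [nextValue, abs_horiz]
  revert h hvw
  rcases v with ⟨_ | _, _ | _ | _⟩ <;> rcases w with ⟨_ | _, _ | _ | _⟩ <;>
    simp [Adj, abs_of_pos h1]

/-- The rate of change of the value along an edge of the hexagon, up to a factor of `2`. -/
theorem rate_bounds (i : ℕ) {φ : ℝ} (hφ : 1 ≤ φ) (hφ' : 4 * φ ≤ top i) {v w : HexVertex}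
    {t l : Fin 7} (h : Adj v w) (hp : Pivot v w t l) :
    scale i / 2 * coord i φ (nextValue i φ w) (horiz i w) t ≤
        |nextValue i φ w - nextValue i φ v| ∧
      |nextValue i φ w - nextValue i φ v| ≤
        scale i * coord i φ (nextValue i φ w) (horiz i w) t := by
  have h1 := width_pos i
  have h2 := width_le_half i
  have h3 := scale_pos i
  have ht : t ∈ zeroSet v ∧ t ∉ zeroSet w := by
    obtain ⟨ht, hl, hw⟩ := hp
    refine ⟨ht, fun h => ?_⟩
    rw [hw, Finset.mem_insert] at h
    rcases h with rfl | h
    · exact hl ht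
    · exact (Finset.mem_erase.mp h).1 rfl
  have h4 : ∀ x : ℝ, scale i * (x / scale i) = x := fun x => mul_div_cancel₀ x h3.ne'
  have h5 : ∀ x : ℝ, scale i / 2 * (x / scale i) = x / 2 := fun x => by field_simp
  have ha1 := le_abs_self (nextValue i φ w - nextValue i φ v)
  have ha2 := neg_le_abs (nextValue i φ w - nextValue i φ v)
  have ha3 := le_abs.mp (le_refl |nextValue i φ w - nextValue i φ v|)
  generalize |nextValue i φ w - nextValue i φ v| = a at ha1 ha2 ha3 ⊢
  clear hp
  revert h ht
  simp only [nextValue, abs_horiz] at ha1 ha2 ha3 ⊢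
  rcases v with ⟨_ | _, _ | _ | _⟩ <;> rcases w with ⟨_ | _, _ | _ | _⟩ <;>
    first
    | (intro h; exact absurd h (by decide))
    | (rintro -
       fin_cases t <;>
         first
         | (intro h; exact absurd h (by decide))
         | (rintro -
            rcases ha3 with ha3 | ha3 <;> simp [coord, horiz, h4, h5] at ha1 ha2 ha3 ⊢ <;>
              constructor <;> linarith))

/-- With the value of the level below fixed, the variables of a level are determined by the choice of
two adjacent edges of the hexagon. -/
theorem eq_zero_of_block (i : ℕ) (v : HexVertex) {x : Fin 7 → ℝ} (h0 : ∀ t ∈ zeroSet v, x t = 0)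
    (h : ∀ r, ∑ t, block i r t * x t = 0) : x = 0 := by
  have hs := scale_pos i
  have e0 : x 5 + x 6 = 0 := by simpa [block, Fin.sum_univ_succ] using h 0
  have e1 : x 0 = scale i * x 1 + scale i * x 5 := by
    have := h 1; simp [block, Fin.sum_univ_succ] at this; linarith
  have e2 : x 0 = scale i * x 2 - scale i * x 5 := by
    have := h 2; simp [block, Fin.sum_univ_succ] at this; linarith
  have e3 : x 0 = -(scale i * x 3) - scale i * x 5 := by
    have := h 3; simp [block, Fin.sum_univ_succ] at this; linarith
  have e4 : x 0 = -(scale i * x 4) + scale i * x 5 := by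
    have := h 4; simp [block, Fin.sum_univ_succ] at this; linarith
  have hz : ∀ a, scale i * a = 0 → a = 0 := fun a ha => (mul_eq_zero.mp ha).resolve_left hs.ne'
  have e6 : scale i * x 6 = -(scale i * x 5) := by rw [← mul_neg]; congr 1; linarith
  have hv : ∀ t ∈ zeroSet v, scale i * x t = 0 := fun t ht => by rw [h0 t ht, mul_zero]
  have key : x 0 = 0 ∧ scale i * x 5 = 0 := by
    rcases v with ⟨_ | _, _ | _ | _⟩ <;> simp only [zeroSet, Finset.mem_insert,
      Finset.mem_singleton, forall_eq_or_imp, forall_eq] at hv <;> obtain ⟨hv1, hv2⟩ := hv <;>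
      constructor <;> linarith
  obtain ⟨k0, k5⟩ := key
  ext t
  fin_cases t
  · exact k0
  · exact hz (x 1) (by linarith)
  · exact hz (x 2) (by linarith)
  · exact hz (x 3) (by linarith)
  · exact hz (x 4) (by linarith)
  · exact hz (x 5) k5
  · exact hz (x 6) (by linarith)

/-! ### The linear program and its vertices -/

/-- The linear program with `n` levels. Row `5 * i + r` is equation `r` of level `i`, and column
`7 * i + t` is variable `t` of level `i`. The value of the last level is maximized. -/
def program (n : ℕ) : LinearProgram (Fin (n * 5)) (Fin (n * 7)) where
  A p q := (if (q.divNat : ℕ) = p.divNat then block p.divNat p.modNat q.modNat else 0) +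
    (if (q.divNat : ℕ) + 1 = p.divNat then (if q.modNat = 0 then link p.modNat else 0) else 0)
  b p := rhs p.divNat p.modNat - if (p.divNat : ℕ) = 0 then link p.modNat else 0
  c q := if (q.divNat : ℕ) + 1 = n then (if q.modNat = 0 then 1 else 0) else 0

/-- The vector of all variables, given level by level. -/
def pack (n : ℕ) (D : ℕ → Fin 7 → ℝ) (q : Fin (n * 7)) : ℝ := D q.divNat q.modNat

theorem sum_pack (n : ℕ) (g : ℕ → Fin 7 → ℝ) :
    ∑ q : Fin (n * 7), g q.divNat q.modNat = ∑ k ∈ Finset.range n, ∑ t, g k t := by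
  rw [Finset.sum_range (fun k => ∑ t, g k t), ← Fintype.sum_prod_type']
  exact finProdFinEquiv.symm.sum_comp (fun p : Fin n × Fin 7 => g p.1 p.2)

theorem mulVec_pack (n : ℕ) (D : ℕ → Fin 7 → ℝ) (p : Fin (n * 5)) :
    (program n).A.mulVec (pack n D) p = ∑ t, block p.divNat p.modNat t * D p.divNat t +
      if (p.divNat : ℕ) = 0 then 0 else link p.modNat * D (p.divNat - 1) 0 := by
  have hi : (p.divNat : ℕ) < n := p.divNat.2
  simp only [Matrix.mulVec, dotProduct, program, pack]
  rw [sum_pack n (fun k t => ((if k = p.divNat then block p.divNat p.modNat t else 0) +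
    (if k + 1 = p.divNat then (if t = 0 then link p.modNat else 0) else 0)) * D k t)]
  generalize p.modNat = r
  generalize (p.divNat : ℕ) = i at hi
  simp only [add_mul, Finset.sum_add_distrib]
  congr 1
  · rw [Finset.sum_eq_single i (fun k _ hk => by simp [hk])
      (fun h => absurd (Finset.mem_range.mpr hi) h)]
    simp
  · rcases i with _ | i
    · simp
    · rw [Finset.sum_eq_single i (fun k _ hk => by simp [hk])
        (fun h => absurd (Finset.mem_range.mpr (by omega)) h)]
      simp

theorem objective_pack {n : ℕ} (hn : 1 ≤ n) (D : ℕ → Fin 7 → ℝ) :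
    (program n).c ⬝ᵥ pack n D = D (n - 1) 0 := by
  simp only [dotProduct, program, pack]
  rw [sum_pack n (fun k t => (if k + 1 = n then (if t = 0 then (1 : ℝ) else 0) else 0) * D k t)]
  obtain ⟨m, rfl⟩ : ∃ m, n = m + 1 := ⟨n - 1, by omega⟩
  rw [Finset.sum_eq_single m (fun k _ hk => by simp [hk]) (fun h => absurd (by simp) h)]
  simp

/-- The vertex of the program at which level `i` is at the vertex `s i` of its hexagon. -/
def point (n : ℕ) (s : ℕ → HexVertex) : Fin (n * 7) → ℝ :=
  pack n (fun i => coord i (value s i) (value s (i + 1)) (horiz i (s i)))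

theorem mulVec_point (n : ℕ) (s : ℕ → HexVertex) :
    (program n).A.mulVec (point n s) = (program n).b := by
  ext p
  rw [point, mulVec_pack]
  have h := sum_block_coord p.divNat (value s p.divNat) (value s (p.divNat + 1))
    (horiz p.divNat (s p.divNat)) p.modNat
  simp only [program]
  rw [← h]
  generalize p.modNat = r
  generalize (p.divNat : ℕ) = i
  rcases i with _ | i
  · simp [value]
  · simp [coord]

theorem objective_point {n : ℕ} (hn : 1 ≤ n) (s : ℕ → HexVertex) :
    (program n).c ⬝ᵥ point n s = value s n := by
  rw [point, objective_pack hn]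
  simp [coord, Nat.sub_add_cancel hn]

theorem point_eq_zero {n : ℕ} {s : ℕ → HexVertex} {q : Fin (n * 7)}
    (h : q.modNat ∈ zeroSet (s q.divNat)) : point n s q = 0 :=
  (coord_zero_or_pos _ (value_bounds s _).1 (value_bounds s _).2 _ _).1 h

theorem point_pos {n : ℕ} {s : ℕ → HexVertex} {q : Fin (n * 7)}
    (h : q.modNat ∉ zeroSet (s q.divNat)) : 0 < point n s q :=
  (coord_zero_or_pos _ (value_bounds s _).1 (value_bounds s _).2 _ _).2 h

/-- The variables that do not vanish at a vertex have linearly independent columns. -/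
theorem eq_zero_of_mulVec {n : ℕ} (s : ℕ → HexVertex) {d : Fin (n * 7) → ℝ}
    (hA : (program n).A.mulVec d = 0)
    (hd : ∀ q : Fin (n * 7), q.modNat ∈ zeroSet (s q.divNat) → d q = 0) : d = 0 := by
  have hdiv : ∀ {m : ℕ} (k : Fin n) (t : Fin m), (finProdFinEquiv (k, t)).divNat = k ∧
      (finProdFinEquiv (k, t)).modNat = t := fun k t =>
    Prod.ext_iff.mp (finProdFinEquiv.symm_apply_apply (k, t))
  obtain ⟨D, rfl⟩ : ∃ D, d = pack n D := by
    refine ⟨fun k t => if h : k < n then d (finProdFinEquiv (⟨k, h⟩, t)) else 0, ?_⟩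
    ext q
    simp only [pack, q.divNat.2, dite_true]
    exact congrArg d (finProdFinEquiv.apply_symm_apply q).symm
  have key : ∀ k, k < n → D k = 0 := by
    intro k
    induction k with
    | zero =>
      intro hk
      refine eq_zero_of_block 0 (s 0) (fun t ht => ?_) fun r => ?_
      · have := hd (finProdFinEquiv (⟨0, hk⟩, t))
        simpa [pack, hdiv, ht] using this
      · have := congrFun hA (finProdFinEquiv (⟨0, hk⟩, r))
        simpa [mulVec_pack, hdiv] using this
    | succ k ih =>
      intro hk
      refine eq_zero_of_block (k + 1) (s (k + 1)) (fun t ht => ?_) fun r => ?_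
      · have := hd (finProdFinEquiv (⟨k + 1, hk⟩, t))
        simpa [pack, hdiv, ht] using this
      · have := congrFun hA (finProdFinEquiv (⟨k + 1, hk⟩, r))
        simpa [mulVec_pack, hdiv, ih (by omega)] using this
  ext q
  exact congrFun (key _ q.divNat.2) q.modNat

theorem value_congr {s s' : ℕ → HexVertex} {n : ℕ} (h : ∀ k < n, s k = s' k) :
    value s n = value s' n := by
  induction n with
  | zero => rfl
  | succ n ih => rw [value, value, ih fun k hk => h k (by omega), h n (by omega)]

theorem value_update_of_le (s : ℕ → HexVertex) {i n : ℕ} (h : n ≤ i) (w : HexVertex) :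
    value (Function.update s i w) n = value s n :=
  value_congr fun k hk => Function.update_of_ne (by omega) _ _

theorem value_update_succ (s : ℕ → HexVertex) (i : ℕ) (w : HexVertex) :
    value (Function.update s i w) (i + 1) = nextValue i (value s i) w := by
  rw [value, value_update_of_le s le_rfl, Function.update_self]

/-- A change of level `i` is passed on to the higher levels up to sign. -/
theorem value_update_sub (s : ℕ → HexVertex) {i n : ℕ} (hi : i < n) (w : HexVertex) (d : Bool) :
    (if d then -1 else 1) * (value (Function.update s i w) n - value s n) =
      (if levelDir s n d i then -1 else 1) *
        (nextValue i (value s i) w - nextValue i (value s i) (s i)) := by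
  induction n generalizing d with
  | zero => omega
  | succ n ih =>
    rcases eq_or_ne i n with rfl | hne
    · rw [value_update_succ]
      simp [levelDir, value]
    · have hn : Function.update s i w n = s n := Function.update_of_ne (by omega) _ _
      rw [levelDir, if_neg hne, ← ih (by omega), value, value, hn]
      simp only [nextValue]
      cases (s n).1 <;> cases d <;> simp

/-- A step along an edge of a hexagon improves the objective if and only if it advances. -/
theorem advances_iff (s : ℕ → HexVertex) {i n : ℕ} (hi : i < n) {w : HexVertex}
    (h : Adj (s i) w) :
    Advances s n false i w ↔ value s n < value (Function.update s i w) n := by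
  have hv := value_update_sub s hi w false
  have hb := value_bounds s i
  have := nextValue_lt_iff i hb.1 hb.2 h (levelDir s n false i)
  simp only [Advances, hi, h, true_and, this]
  generalize levelDir s n false i = e at hv ⊢
  cases e <;> simp at hv ⊢ <;> constructor <;> intro <;> linarith

theorem abs_value_update_sub (s : ℕ → HexVertex) {i n : ℕ} (hi : i < n) (w : HexVertex) :
    |value (Function.update s i w) n - value s n| =
      |nextValue i (value s i) w - nextValue i (value s i) (s i)| := by
  have hv := value_update_sub s hi w false
  generalize levelDir s n false i = e at hv
  cases e <;> simp at hv <;> rw [hv]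
  exact abs_sub_comm _ _

/-! ### Pivot operations at the bases of the long path -/

/-- The basis `β` belongs to the vertex of state `s`: the nonbasic variables are those that vanish
there. -/
structure IsBasisOf {n : ℕ} (β : Fin (n * 5) → Fin (n * 7)) (s : ℕ → HexVertex) : Prop where
  injective : Function.Injective β
  mem_range_iff : ∀ q, q ∈ Set.range β ↔ q.modNat ∉ zeroSet (s q.divNat)

namespace IsBasisOf

variable {n : ℕ} {β : Fin (n * 5) → Fin (n * 7)} {s : ℕ → HexVertex}

theorem isUnit_det (h : IsBasisOf β s) : IsUnit ((program n).basisMatrix β).det :=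
  (program n).isUnit_basisMatrix h.injective fun _ hA hd => eq_zero_of_mulVec s hA fun q hq =>
    hd q (by rw [h.mem_range_iff]; exact not_not.mpr hq)

theorem isFeasibleBasis (h : IsBasisOf β s) : (program n).IsFeasibleBasis β := by
  refine ⟨h.isUnit_det, fun i => ?_⟩
  rw [(program n).basicValue_eq h.injective h.isUnit_det (mulVec_point n s)]
  · exact (point_pos ((h.mem_range_iff _).mp ⟨i, rfl⟩)).le
  · exact fun k hk => point_eq_zero (not_not.mp (mt (h.mem_range_iff k).mpr hk))

/-- Moving one level along an edge of its hexagon is moving along an edge of the program. -/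
theorem isEdge (h : IsBasisOf β s) {q : Fin (n * 7)} {w : HexVertex} {l : Fin 7}
    (hp : Pivot (s q.divNat) w q.modNat l) :
    (program n).IsEdge β (point n s) (point n (Function.update s q.divNat w)) q
      (finProdFinEquiv (q.divNat, l)) := by
  obtain ⟨hq, hl, hw⟩ := hp
  have hq_eq : ∀ k : Fin (n * 7), (k.divNat : ℕ) = q.divNat → k.modNat = q.modNat → k = q :=
    fun k h1 h2 => finProdFinEquiv.symm.injective (Prod.ext (Fin.ext h1) h2)
  have hl_eq : ∀ k : Fin (n * 7), (k.divNat : ℕ) = q.divNat → k.modNat = l →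
      k = finProdFinEquiv (q.divNat, l) := fun k h1 h2 =>
    (Equiv.symm_apply_eq _).mp (Prod.ext (Fin.ext h1) h2)
  have hl_div := Prod.ext_iff.mp (finProdFinEquiv.symm_apply_apply (q.divNat, l))
  simp only [finProdFinEquiv_symm_apply] at hl_div
  have hmem : ∀ k : Fin (n * 7), k.modNat ∈ zeroSet (Function.update s q.divNat w k.divNat) ↔
      k = finProdFinEquiv (q.divNat, l) ∨ (k ≠ q ∧ k.modNat ∈ zeroSet (s k.divNat)) := by
    intro k
    rcases eq_or_ne (k.divNat : ℕ) q.divNat with hk | hk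
    · rw [hk, Function.update_self, hw, Finset.mem_insert, Finset.mem_erase]
      refine or_congr ⟨hl_eq k hk, ?_⟩ (and_congr_left fun _ => not_congr ⟨hq_eq k hk, ?_⟩)
      · rintro rfl; exact hl_div.2
      · rintro rfl; rfl
    · rw [Function.update_of_ne hk]
      have h1 : k ≠ q := by rintro rfl; exact hk rfl
      have h2 : k ≠ finProdFinEquiv (q.divNat, l) := by
        rintro rfl; exact hk (congrArg Fin.val hl_div.1)
      simp [h1, h2]
  have hl_mem : finProdFinEquiv (q.divNat, l) ∈ Set.range β := by
    rw [h.mem_range_iff, hl_div.1, hl_div.2]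
    exact hl
  have hoff : ∀ k, k ∉ Set.range β ↔ k.modNat ∈ zeroSet (s k.divNat) := fun k => by
    rw [h.mem_range_iff, not_not]
  have hq_off : q ∉ Set.range β := (hoff q).mpr hq
  refine ⟨h.injective, h.isUnit_det, mulVec_point n s, mulVec_point n _,
    fun k hk => point_eq_zero ((hoff k).mp hk), fun k hk => point_pos ((h.mem_range_iff k).mp hk),
    hq_off, hl_mem, fun k hk hkq => point_eq_zero ?_, point_eq_zero ?_, point_pos ?_,
    fun k hk hkl => point_pos ?_⟩
  · exact (hmem k).mpr (Or.inr ⟨hkq, (hoff k).mp hk⟩)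
  · exact (hmem _).mpr (Or.inl rfl)
  · rw [hmem]
    rintro (h1 | h1)
    · rw [← h1] at hl_mem
      exact hq_off hl_mem
    · exact h1.1 rfl
  · rw [hmem]
    rintro (h1 | h1)
    · exact hkl h1
    · exact (h.mem_range_iff k).mp hk h1.2

theorem update (h : IsBasisOf β s) {q : Fin (n * 7)} {w : HexVertex} {l : Fin 7}
    (hp : Pivot (s q.divNat) w q.modNat l) {i : Fin (n * 5)}
    (hi : β i = finProdFinEquiv (q.divNat, l)) :
    IsBasisOf (Function.update β i q) (Function.update s q.divNat w) := by
  have e := h.isEdge hp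
  have hne : ∀ k, β k ≠ q := fun k hk => e.entering ⟨k, hk⟩
  refine ⟨fun a b hab => ?_, fun k => ⟨?_, fun hk => ?_⟩⟩
  · rcases eq_or_ne a i with rfl | ha <;> rcases eq_or_ne b a with rfl | hb
    · rfl
    · rw [Function.update_self, Function.update_of_ne hb] at hab
      exact absurd hab.symm (hne b)
    · rfl
    · rw [Function.update_of_ne ha] at hab
      rcases eq_or_ne b i with rfl | hbi
      · rw [Function.update_self] at hab
        exact absurd hab (hne a)
      · rw [Function.update_of_ne hbi] at hab
        exact h.injective hab
  · rintro ⟨a, rfl⟩ hz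
    have h0 := point_eq_zero hz
    rcases eq_or_ne a i with rfl | ha
    · rw [Function.update_self] at h0
      exact e.right_entering.ne' h0
    · rw [Function.update_of_ne ha] at h0
      exact (e.right_pos _ ⟨a, rfl⟩ fun hl => ha (h.injective (hl.trans hi.symm))).ne' h0
  · have hpos := point_pos hk
    rcases eq_or_ne k q with rfl | hkq
    · exact ⟨i, Function.update_self _ _ _⟩
    · obtain ⟨a, rfl⟩ : k ∈ Set.range β := by
        by_contra hk'
        exact hpos.ne' (e.right_eq_zero k hk' hkq)
      refine ⟨a, Function.update_of_ne ?_ _ _⟩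
      rintro rfl
      rw [hi] at hpos
      exact hpos.ne' e.right_leaving

/-- A nonbasic variable is improving if and only if its edge advances. -/
theorem improving_iff (hn : 1 ≤ n) (h : IsBasisOf β s) {q : Fin (n * 7)} {w : HexVertex}
    {l : Fin 7} (hadj : Adj (s q.divNat) w) (hp : Pivot (s q.divNat) w q.modNat l) :
    (program n).Improving β q ↔ Advances s n false q.divNat w := by
  rw [(h.isEdge hp).improving_iff, objective_point hn, objective_point hn,
    advances_iff s q.divNat.2 hadj]

theorem exists_advances (hn : 1 ≤ n) (h : IsBasisOf β s) {q : Fin (n * 7)}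
    (hq : (program n).Improving β q) : ∃ w l, Adj (s q.divNat) w ∧
      Pivot (s q.divNat) w q.modNat l ∧ Advances s n false q.divNat w := by
  have hz : q.modNat ∈ zeroSet (s q.divNat) := by
    by_contra hz
    obtain ⟨i, rfl⟩ := (h.mem_range_iff q).mpr hz
    exact hq.ne' ((program n).reducedCost_basic h.isUnit_det i)
  obtain ⟨w, l, hadj, hp⟩ := exists_pivot_of_mem hz
  exact ⟨w, l, hadj, hp, (h.improving_iff hn hadj hp).mp hq⟩

theorem exists_improving (hn : 1 ≤ n) (h : IsBasisOf β s) {i : ℕ} {w : HexVertex}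
    (hw : Advances s n false i w) : ∃ (q : Fin (n * 7)) (l : Fin 7), (q.divNat : ℕ) = i ∧
      Pivot (s q.divNat) w q.modNat l ∧ (program n).Improving β q := by
  obtain ⟨t, l, hp⟩ := exists_pivot_of_adj hw.2.1
  have hdiv := Prod.ext_iff.mp
    (finProdFinEquiv.symm_apply_apply ((⟨i, hw.1⟩ : Fin n), t))
  simp only [finProdFinEquiv_symm_apply] at hdiv
  refine ⟨finProdFinEquiv (⟨i, hw.1⟩, t), l, by rw [hdiv.1], ?_, ?_⟩
  · rw [hdiv.1, hdiv.2]; exact hp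
  · rw [h.improving_iff hn (l := l) (w := w)]
    · rw [hdiv.1]; exact hw
    · rw [hdiv.1]; exact hw.2.1
    · rw [hdiv.1, hdiv.2]; exact hp

/-- The gain of a step of level `i` is the change of the value of that level. -/
theorem gain (hn : 1 ≤ n) (h : IsBasisOf β s) {q : Fin (n * 7)} {w : HexVertex} {l : Fin 7}
    (hp : Pivot (s q.divNat) w q.modNat l) (hw : Advances s n false q.divNat w) :
    (program n).reducedCost β q * point n (Function.update s q.divNat w) q =
      |nextValue q.divNat (value s q.divNat) w -
        nextValue q.divNat (value s q.divNat) (s q.divNat)| := by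
  rw [(h.isEdge hp).reducedCost_mul, objective_point hn, objective_point hn,
    ← abs_value_update_sub s q.divNat.2, abs_of_pos]
  exact sub_pos.mpr ((advances_iff s q.divNat.2 hw.2.1).mp hw)

theorem reducedCost_bounds (hn : 1 ≤ n) (h : IsBasisOf β s) {q : Fin (n * 7)} {w : HexVertex}
    {l : Fin 7} (hp : Pivot (s q.divNat) w q.modNat l) (hw : Advances s n false q.divNat w) :
    scale q.divNat / 2 ≤ (program n).reducedCost β q ∧
      (program n).reducedCost β q ≤ scale q.divNat := by
  have hb := value_bounds s q.divNat
  have hr := rate_bounds q.divNat hb.1 hb.2 hw.2.1 hp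
  have hy : coord q.divNat (value s q.divNat) (nextValue q.divNat (value s q.divNat) w)
      (horiz q.divNat w) q.modNat = point n (Function.update s q.divNat w) q := by
    simp only [point, pack]
    rw [value_update_succ, value_update_of_le s le_rfl, Function.update_self]
  rw [hy, ← h.gain hn hp hw] at hr
  have hpos := (h.isEdge hp).right_entering
  exact ⟨le_of_mul_le_mul_right hr.1 hpos, le_of_mul_le_mul_right hr.2 hpos⟩

/-- On the long path, each of the three rules selects a variable of the lowest level that has
improving variables. -/
theorem not_advances_of_selects (hn : 1 ≤ n) (h : IsBasisOf β s) {r : ℕ}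
    (hpath : OnPath s n false r) {q : Fin (n * 7)} {ρ : PivotRule}
    (hq : (program n).Selects β q ρ) {w : HexVertex} {l : Fin 7}
    (hp : Pivot (s q.divNat) w q.modNat l) (hw : Advances s n false q.divNat w) :
    ∀ k < (q.divNat : ℕ), ∀ v, ¬ Advances s n false k v := by
  intro k hk v hv
  obtain ⟨q', l', rfl, hp', hq'⟩ := h.exists_improving hn hv
  cases ρ with
  | dantzig =>
    have h1 := hq.2 q'
    have h2 := (h.reducedCost_bounds hn hp' hv).1
    have h3 := (h.reducedCost_bounds hn hp hw).2
    linarith [scale_lt hk]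
  | bland =>
    have h1 : (q : ℕ) ≤ q' := hq.2 q' hq'
    have h2 : (q' : ℕ) / 7 < (q : ℕ) / 7 := hk
    omega
  | largestIncrease =>
    obtain ⟨θ, hθ, hle⟩ := hq.2 q' hq' _ (h.isEdge hp').feasibleStep_right
    have h1 := mul_le_mul_of_nonneg_left ((h.isEdge hp).le_of_feasibleStep hθ) (le_of_lt hq.1)
    rw [h.gain hn hp hw, abs_eq_width _ _ hw.2.1 (hpath.half_eq hw hv hk)] at h1
    rw [h.gain hn hp' hv] at hle
    have hb := value_bounds s q'.divNat
    linarith [width_le_abs _ hb.1 hb.2 hv.2.1, width_lt hk]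

/-- Every iteration at a basis of the long path is a pivot to the next basis of the path. -/
theorem step (hn : 1 ≤ n) (h : IsBasisOf β s) {r : ℕ} (hpath : OnPath s n false (r + 1))
    (o : Option (Fin (n * 5) → Fin (n * 7))) (ho : (program n).IsOutcome β o) :
    ∃ β', o = some β' ∧ ∃ s', IsBasisOf β' s' ∧ OnPath s' n false r := by
  have himp : ∀ {q ρ}, (program n).Selects β q ρ → (program n).Improving β q := by
    rintro q (_ | _ | _) hq <;> exact hq.1
  cases o with
  | none =>
    exfalso
    rcases ho with ho | ⟨ρ, q, hq, ho⟩
    · obtain ⟨i, w, hw⟩ := hpath.exists_advances (by omega)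
      obtain ⟨q, -, -, -, hq⟩ := h.exists_improving hn hw
      exact ho q hq
    · obtain ⟨w, l, -, hp, -⟩ := h.exists_advances hn (himp hq)
      obtain ⟨i, hi⟩ := (h.isEdge hp).leaving
      exact ho i (((h.isEdge hp).mayLeave_iff i).mpr hi)
  | some β' =>
    obtain ⟨ρ, q, i, hq, hi, rfl⟩ := ho
    obtain ⟨w, l, -, hp, hw⟩ := h.exists_advances hn (himp hq)
    exact ⟨_, rfl, _, h.update hp (((h.isEdge hp).mayLeave_iff i).mp hi),
      hpath.step hw (h.not_advances_of_selects hn hpath hq hp hw)⟩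

end IsBasisOf

/-! ### The initial basis and the size -/

/-- The basis of the vertex at which all levels are at the lowest vertex of their hexagon. -/
def startBasis (n : ℕ) (p : Fin (n * 5)) : Fin (n * 7) :=
  finProdFinEquiv (p.divNat, ![0, 3, 4, 5, 6] p.modNat)

theorem isBasisOf_startBasis (n : ℕ) : IsBasisOf (startBasis n) fun _ => (false, 0) := by
  have hinj : Function.Injective (![0, 3, 4, 5, 6] : Fin 5 → Fin 7) := by decide
  have hrange : ∀ t : Fin 7, t ∉ zeroSet (false, 0) → ∃ r, (![0, 3, 4, 5, 6] : Fin 5 → Fin 7) r = t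
      := by decide
  have hmem : ∀ r, (![0, 3, 4, 5, 6] : Fin 5 → Fin 7) r ∉ zeroSet (false, 0) := by decide
  refine ⟨fun a b hab => ?_, fun q => ⟨?_, fun hq => ?_⟩⟩
  · have h := Prod.ext_iff.mp (finProdFinEquiv.injective hab)
    exact finProdFinEquiv.symm.injective (Prod.ext h.1 (hinj h.2))
  · rintro ⟨p, rfl⟩
    have h := (Prod.ext_iff.mp (finProdFinEquiv.symm_apply_apply
      (p.divNat, (![0, 3, 4, 5, 6] : Fin 5 → Fin 7) p.modNat))).2
    simp only [finProdFinEquiv_symm_apply] at h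
    rw [startBasis, h]
    exact hmem _
  · obtain ⟨r, hr⟩ := hrange _ hq
    refine ⟨finProdFinEquiv (q.divNat, r), ?_⟩
    have h := Prod.ext_iff.mp (finProdFinEquiv.symm_apply_apply (q.divNat, r))
    simp only [finProdFinEquiv_symm_apply] at h
    rw [startBasis, h.1, h.2, hr]
    exact finProdFinEquiv.apply_symm_apply q

theorem size_program_le (n : ℕ) : (program n).size ≤ 82 * n := by
  -- A nonzero entry lies in a column of the level of its row or of the level below. Hence it is
  -- determined by the row, the index of the variable and one bit: at most `5 * 7 * 2` per level.
  let f : Fin (n * 5) × Fin (n * 7) → Fin (n * 5) × Fin 7 × Fin 2 := fun x =>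
    (x.1, x.2.modNat, if (x.2.divNat : ℕ) = x.1.divNat then 0 else 1)
  have hinj : Set.InjOn f {p | (program n).A p.1 p.2 ≠ 0} := by
    rintro ⟨p, q⟩ hpq ⟨p', q'⟩ hpq' heq
    simp only [f, Prod.mk.injEq] at heq
    obtain ⟨rfl, h1, h2⟩ := heq
    have hlev : ∀ q, (program n).A p q ≠ 0 →
        (q.divNat : ℕ) = p.divNat ∨ (q.divNat : ℕ) + 1 = p.divNat := by
      intro q hq
      by_contra! hcon
      exact hq (by simp only [program, if_neg hcon.1, if_neg hcon.2, add_zero])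
    have hdiv : (q.divNat : ℕ) = q'.divNat := by
      have ha := hlev q hpq
      have hb := hlev q' hpq'
      split_ifs at h2 with h3 h4 h4
      · omega
      · simp at h2
      · simp at h2
      · omega
    rw [Prod.mk.injEq]
    exact ⟨rfl, finProdFinEquiv.symm.injective (Prod.ext (Fin.ext hdiv) h1)⟩
  have hcard := Set.ncard_le_ncard_of_injOn f (t := Set.univ) (fun _ _ => Set.mem_univ _) hinj
  simp only [Set.ncard_univ, Nat.card_eq_fintype_card, Fintype.card_prod, Fintype.card_fin] at hcard
  simp only [LinearProgram.size, Fintype.card_fin]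
  omega

end

end HexLP

/-! ### The number of pivot operations -/

theorem corollary3 :
    ∃ (m N : ℕ → ℕ) (L : ∀ n, LinearProgram (Fin (m n)) (Fin (N n)))
      (β₀ : ∀ n, Fin (m n) → Fin (N n)) (C c : ℝ), 0 < c ∧
      ∀ n : ℕ, 1 ≤ n →
        ((L n).size : ℝ) ≤ C * n ∧
        (L n).IsFeasibleBasis (β₀ n) ∧
        ∀ σ : List (Fin (m n) → Fin (N n)) → PMF (Option (Fin (m n) → Fin (N n))),
          (L n).IsCombination σ →
          ∀ T : ℕ, c * 2 ^ n ≤ (T : ℝ) →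
            (LinearProgram.pivotCount σ T [β₀ n]).toMeasure {k : ℕ | c * 2 ^ n ≤ (k : ℝ)} = 1 := by
  refine ⟨fun n => n * 5, fun n => n * 7, HexLP.program, HexLP.startBasis, 82, 1, one_pos,
    fun n hn => ⟨by exact_mod_cast HexLP.size_program_le n,
      (HexLP.isBasisOf_startBasis n).isFeasibleBasis, fun σ hσ T hT => ?_⟩⟩
  rw [PMF.toMeasure_apply_eq_one_iff _ (MeasurableSet.of_discrete)]
  intro k hk
  have hmin := LinearProgram.min_le_of_mem_support_pivotCount
    (Good := fun r β => ∃ s, HexLP.IsBasisOf β s ∧ HexLP.OnPath s n false r)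
    (fun r β hβ o ho => by
      obtain ⟨s, hs, hpath⟩ := hβ
      exact hs.step hn hpath o ho)
    hσ T (HexLP.pathLength n) (HexLP.startBasis n) []
    ⟨_, HexLP.isBasisOf_startBasis n, HexLP.onPath_start (fun _ => rfl) n⟩ k hk
  have hlen := HexLP.two_pow_le_pathLength hn
  rw [one_mul] at hT
  have hT' : 2 ^ n ≤ T := by exact_mod_cast hT
  have : 2 ^ n ≤ k := by omega
  rw [Set.mem_ofPred_eq, one_mul]
  exact_mod_cast this
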